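/- Let $\mathcal X$ be a discrete (countable) feature space, $\mathcal Y=\{\pm1\}$, and let $\mathcal P$ be a probability distribution on $\mathcal X\times\mathcal Y$. Let $D=((x_1,y_1),\dots,(x_n,y_n))$, $n\ge 1$, be an i.i.d. sample from $\mathcal P$, and let $(X,Y)\sim\mathcal P$. *Complexity condition.* For a class $\mathcal G$ of functions on $\mathcal X\times\mathcal Y$ put $R_D(\mathcal G)=\frac1n\,\mathbb E_{\sigma}\big[\sup_{g\in\mathcal G}\sum_{i=1}^n\sigma_i g(x_i,y_i)\big]$ with $\sigma$ uniform on $\{\pm1\}^n$. Let $\mathcal F$ be a set of functions $\mathcal X\to[0,1]$, let $f_0\in\mathcal F$, and let $\mathcal H=\{\mathbf 1_{p_1<f(x)\le p_2}: p_1,p_2\in\mathbb R,\ f\in\mathcal F\}$ (functions not depending on $y$). Let $\delta>0$ and $\epsilon$ be real numbers with $$\mathbb E_D R_D(\mathcal H)+\sqrt{\frac{2\ln(8/\delta)}{n}}<\frac{\epsilon}{2}.$$ *PAV algorithm.* Order the sample so that $f_0(x_1)\le\dots\le f_0(x_n)$, ordering data with equal scores $f_0(x_i)$ so that they receive equal values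 $z_i$ below (for instance, positive labels first). Let $S_k=\#\{j\le k: y_j=1\}$, let $Z_k$ be the height at abscissa $k$ of the lower boundary of the convex hull of the points $(i,S_i)$, $0\le i\le n$, and let $z_i=Z_i-Z_{i-1}$. For every $D$ let $g^*=g^*_D$ be any continuous nondecreasing function $[0,1]\to[0,1]$ with $g^*(f_0(x_i))=z_i$ for $i=1,\dots,n$. *Population curves.* Let $F(t)=\mathcal P(f_0(X)\le t)$ and $G(t)=\mathcal P(f_0(X)\le t,\,Y=1)$. Let $cv:[0,1]\to[0,1]$ be the lower boundary of the convex hull of the curve $\{(F(t),G(t)):t\in\mathbb R\}$ (which includes the point $(0,0)$, attained for $t<0$). Let $G_e(t)=\mathbb E_{(X,Y)\sim\mathcal P}\big[\mathbf 1_{f_0(X)\le t}\,g^*(f_0(X))\big]$, where $g^*$ is held fixed. Then $$\mathbf P_D\Big(\sup_{t\in[0,1]}|G_e(t)-cv(F(t))|>2\epsilon\Big)<5\delta .$$ If moreover $\mathcal P(Y=1\mid f_0(X))$ is almost surely a nondecreasing function of $f_0(X)$, then $$\mathbf P_D\Big(\sup_{t\in[0,1]}|G_e(t)-G(t)|>2\epsilon\Big)<5\delta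 .$$ -/

import Mathlib

open MeasureTheory
open scoped unitInterval

noncomputable section

namespace PAV

/-- The label space `{±1} = ℤˣ` carries the discrete `σ`-algebra. -/
instance discreteLabels : DiscreteMeasurableSpace ℤˣ where
  forall_measurableSet s :=
    ⟨(fun u : ℤˣ => (u : ℤ)) '' s, trivial,
      Set.preimage_image_eq s fun _ _ h => Units.ext h⟩

/-- The lower boundary of the convex hull of a planar set `A`, as a function of the abscissa:
the lowest ordinate at which the vertical line through `x` meets `convexHull ℝ A`. -/
def lowerHull (A : Set (ℝ × ℝ)) (x : ℝ) : ℝ :=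
  sInf {y : ℝ | (x, y) ∈ convexHull ℝ A}

section Rademacher

/-- The (empirical) Rademacher complexity
`R_D(𝒢) = (1/n) E_{s uniform on {±1}^n} [sup_{g ∈ 𝒢} ∑ i, s i * g (D i)]`. -/
def rademacher {Z : Type*} {n : ℕ} (𝒢 : Set (Z → ℝ)) (D : Fin n → Z) : ℝ :=
  (1 / (n : ℝ)) * ((1 / (2 : ℝ) ^ n) *
    ∑ s : Fin n → ℤˣ, ⨆ g : 𝒢, ∑ i, (((s i : ℤˣ) : ℤ) : ℝ) * (g : Z → ℝ) (D i))

/-- The binary classifiers `𝟙[p₁ < f(x) ≤ p₂]`, `f ∈ ℱ`, `p₁ p₂ ∈ ℝ`, seen as functions of the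
labelled point `(x, y)` that ignore the label `y ∈ {±1} = ℤˣ`. -/
def thresholdClass {X : Type*} (ℱ : Set (X → I)) : Set (X × ℤˣ → ℝ) :=
  {h | ∃ f ∈ ℱ, ∃ p₁ p₂ : ℝ,
    h = fun z => if p₁ < (f z.1 : ℝ) ∧ (f z.1 : ℝ) ≤ p₂ then 1 else 0}

end Rademacher

section Algorithm

/-- `S_k`: the number of positive labels among the first `k` labels. -/
def cumLabels {n : ℕ} (y : Fin n → ℤˣ) (k : ℕ) : ℝ :=
  ∑ j : Fin n, if (j : ℕ) < k ∧ y j = 1 then 1 else 0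

/-- The points `P_k = (k, S_k)`, `k = 0, …, n`. -/
def points {n : ℕ} (y : Fin n → ℤˣ) : Set (ℝ × ℝ) :=
  {p | ∃ k : ℕ, k ≤ n ∧ p = ((k : ℝ), cumLabels y k)}

/-- `Z_k`: the height at `k` of the (lower) convex hull of `P_0, …, P_n`. -/
def hullHeight {n : ℕ} (y : Fin n → ℤˣ) (k : ℕ) : ℝ :=
  lowerHull (points y) (k : ℝ)

/-- `g : [0,1] → [0,1]` is a possible output of the PAV (isotonic regression) algorithm run on
the scores `f₀(x_i)` and the labels of the data set `D`: it is continuous and nondecreasing, and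
for some enumeration of the data by nondecreasing score it takes the value
`z_i = Z_i - Z_{i-1}` at the `i`-th score.  (Indices start from `0` here.)

Data with equal scores have to receive equal values `z_i`. An enumeration that lists positive
labels first among equal scores always achieves this, so an output exists for every `D`; and all
enumerations that achieve it give the same values, as the hull is then affine on each block
of equal scores. -/
def IsPAVOutput {X : Type*} {n : ℕ} (f₀ : X → I) (D : Fin n → X × ℤˣ) (g : I → I) : Prop :=
  Continuous g ∧ Monotone g ∧
    ∃ π : Equiv.Perm (Fin n), Monotone (fun i => f₀ (D (π i)).1) ∧
      ∀ i : Fin n, (g (f₀ (D (π i)).1) : ℝ) =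
        hullHeight (fun j => (D (π j)).2) ((i : ℕ) + 1) -
          hullHeight (fun j => (D (π j)).2) (i : ℕ)

end Algorithm

section Population

variable {X : Type*} [MeasurableSpace X]

/-- `F(t) = P(f₀(X) ≤ t)`. -/
def distF (P : Measure (X × ℤˣ)) (f₀ : X → I) (t : ℝ) : ℝ :=
  P.real {z | (f₀ z.1 : ℝ) ≤ t}

/-- `G(t) = P(f₀(X) ≤ t, Y = 1)`. -/
def distG (P : Measure (X × ℤˣ)) (f₀ : X → I) (t : ℝ) : ℝ :=
  P.real {z | (f₀ z.1 : ℝ) ≤ t ∧ z.2 = 1}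

/-- `cv`: the (lower) convex hull of the curve `t ↦ (F(t), G(t))`. The parameter runs over all of
`ℝ`, so that the curve starts at the origin `(0,0)` (the value for `t < 0`), just as the points
`P_0, …, P_n` of the algorithm do, and `cv` is defined on all of `[0,1]`. -/
def cv (P : Measure (X × ℤˣ)) (f₀ : X → I) (x : ℝ) : ℝ :=
  lowerHull (Set.range fun t : ℝ => (distF P f₀ t, distG P f₀ t)) x

/-- `G_e(t) = E[𝟙[f₀(X) ≤ t] g(f₀(X))]`. -/
def Ge (P : Measure (X × ℤˣ)) (f₀ : X → I) (g : I → I) (t : ℝ) : ℝ :=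
  ∫ z, (if (f₀ z.1 : ℝ) ≤ t then (g (f₀ z.1) : ℝ) else 0) ∂P

/-- `P(Y = 1 | f₀(X))` is a nondecreasing function of `f₀(X)`, almost surely. -/
def MonotoneRegression (P : Measure (X × ℤˣ)) (f₀ : X → I) : Prop :=
  ∃ m : I → ℝ, Monotone m ∧
    P[fun z : X × ℤˣ => if z.2 = 1 then (1 : ℝ) else 0 |
        MeasurableSpace.comap (fun z : X × ℤˣ => f₀ z.1) inferInstance]
      =ᵐ[P] fun z => m (f₀ z.1)

end Population

end PAV

end

/-! Call a sample accurate if, for every interval of scores, the empirical and true probabilities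
differ by at most `ε`, with and without a prescribed label (`IsAccurate`). The proof shows that
accuracy is likely and that it forces the conclusion deterministically.

Likelihood: accuracy amounts to six one-sided uniform deviation bounds over subfamilies of the
threshold class, possibly weighted by a label. Symmetrization (`integral_deviation_le`) bounds each
expected deviation by twice a Rademacher complexity, and label weights do not increase that
complexity (`rademacherFamily_mul_le`). Bounded differences then make each failure have probability
at most `δ / 8`.

Determinism (`IsAccurate.abs_Ge_sub_cv_le`): for a slope `c` in `[0, 1]`, both `G - c F` and `G_e -
c F` are within `ε` of `(S_k - c k) / n` and `(Z_k - c k) / n`. A supporting line of one hull,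
lowered by `ε`, is therefore a minorant of the other curve, hence of its hull; passing from `Z_k` to
`G_e` costs the second `ε`. Tied scores allow comparison only at block ends, which suffices because
the empirical hull has no kink inside a block (`le_cumLabels_of_kinks`). Under monotone regression
the population curve is its own lower hull, so `cv ∘ F = G`. -/

namespace PAV

/-! ### Concentration by bounded differences -/

section Concentration

theorem integrable_of_abs_le {Z : Type*} [MeasurableSpace Z] [DiscreteMeasurableSpace Z]
    (μ : Measure Z) [IsFiniteMeasure μ] {f : Z → ℝ} {B : ℝ}
    (hf : ∀ z, |f z| ≤ B) : Integrable f μ :=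
  Integrable.of_bound (Measurable.of_discrete).aestronglyMeasurable B (ae_of_all _ hf)

theorem abs_integral_le_of_abs_le {Z : Type*} [MeasurableSpace Z] (μ : Measure Z)
    [IsProbabilityMeasure μ] {f : Z → ℝ} {B : ℝ}
    (hf : ∀ z, |f z| ≤ B) : |∫ z, f z ∂μ| ≤ B := by
  simpa using norm_integral_le_of_norm_le_const (μ := μ) (f := f) (C := B) (ae_of_all _ hf)

variable {Z : Type*} [Countable Z] [MeasurableSpace Z] [DiscreteMeasurableSpace Z]

theorem integral_pi_succ (P : Measure Z) [IsProbabilityMeasure P] {n : ℕ}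
    {f : (Fin (n + 1) → Z) → ℝ} {B : ℝ} (hf : ∀ D, |f D| ≤ B) :
    ∫ D, f D ∂(Measure.pi fun _ => P)
      = ∫ D, ∫ z, f (Fin.cons z D) ∂P ∂(Measure.pi fun _ : Fin n => P) := by
  have h := (measurePreserving_piFinSuccAbove (fun _ : Fin (n + 1) => P) 0).symm
  rw [← h.integral_comp', ← integral_prod_symm (fun x : Z × (Fin n → Z) => f (Fin.cons x.1 x.2))]
  · simp [MeasurableEquiv.piFinSuccAbove, Fin.insertNthEquiv]
  · exact integrable_of_abs_le _ fun x => hf _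

/-- **McDiarmid's inequality** in sub-Gaussian form (with a non-optimal constant). -/
theorem integral_exp_le_of_bounded_differences (P : Measure Z) [IsProbabilityMeasure P] {c : ℝ}
    (t : ℝ) : ∀ {n : ℕ} {Φ : (Fin n → Z) → ℝ} {B : ℝ}, (∀ D, |Φ D| ≤ B) →
    (∀ D i z, |Φ (Function.update D i z) - Φ D| ≤ c) →
    ∫ D, Real.exp (t * (Φ D - ∫ D, Φ D ∂(Measure.pi fun _ => P))) ∂(Measure.pi fun _ => P)
      ≤ Real.exp (n * c ^ 2 * t ^ 2 / 2) := by
  intro n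
  induction n with
  | zero =>
    intro Φ B hB hd
    have h : ∀ D, Φ D = Φ default := fun D => by rw [Subsingleton.elim D default]
    simp [h]
  | succ n ih =>
    intro Φ B hB hd
    set Ψ : (Fin n → Z) → ℝ := fun D => ∫ z, Φ (Fin.cons z D) ∂P with hΨ
    have hΨB : ∀ D, |Ψ D| ≤ B := fun D => abs_integral_le_of_abs_le P fun z => hB _
    have hΨd : ∀ D i z, |Ψ (Function.update D i z) - Ψ D| ≤ c := by
      intro D i z
      rw [hΨ]
      simp only
      rw [← integral_sub (integrable_of_abs_le P fun z => hB _)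
        (integrable_of_abs_le P fun z => hB _)]
      refine abs_integral_le_of_abs_le P fun w => ?_
      have := hd (Fin.cons w D) i.succ z
      rwa [← Fin.cons_update] at this
    have hm : ∫ D, Φ D ∂(Measure.pi fun _ => P) = ∫ D, Ψ D ∂(Measure.pi fun _ => P) :=
      integral_pi_succ P hB
    have hbound : ∀ {k : ℕ} {Θ : (Fin k → Z) → ℝ} (_ : ∀ D, |Θ D| ≤ B) (m : ℝ) D,
        |Real.exp (t * (Θ D - m))| ≤ Real.exp (|t| * (B + |m|)) := by
      intro k Θ hΘ m D
      rw [Real.abs_exp]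
      refine Real.exp_le_exp.2 ((le_abs_self _).trans ?_)
      rw [abs_mul]
      exact mul_le_mul_of_nonneg_left ((abs_sub _ _).trans (by linarith [hΘ D])) (abs_nonneg _)
    rw [hm, integral_pi_succ P (hbound hB _)]
    set m := ∫ D, Ψ D ∂(Measure.pi fun _ => P)
    have key : ∀ D, ∫ z, Real.exp (t * (Φ (Fin.cons z D) - m)) ∂P
        ≤ Real.exp (c ^ 2 * t ^ 2 / 2) * Real.exp (t * (Ψ D - m)) := by
      intro D
      obtain ⟨a⟩ : Nonempty Z := by
        by_contra hne
        rw [not_nonempty_iff] at hne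
        exact IsProbabilityMeasure.ne_zero P (Measure.eq_zero_of_isEmpty P)
      -- Any fixed value `a` of the new coordinate serves as a centre. The interval has length `2 *
      -- c`, so Hoeffding's lemma gives the variance proxy `c ^ 2`.
      have hmem : ∀ᵐ z ∂P, Φ (Fin.cons z D) ∈
          Set.Icc (Φ (Fin.cons a D) - c) (Φ (Fin.cons a D) + c) := by
        refine ae_of_all _ fun z => ?_
        have := abs_le.1 (hd (Fin.cons a D) 0 z)
        rw [Fin.update_cons_zero] at this
        constructor <;> linarith
      have hs := ProbabilityTheory.hasSubgaussianMGF_of_mem_Icc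
        (μ := P) (Measurable.of_discrete).aemeasurable hmem
      have h1 := hs.mgf_le t
      have h2 : (((‖Φ (Fin.cons a D) + c - (Φ (Fin.cons a D) - c)‖₊ / 2) ^ 2 : NNReal) : ℝ)
          = c ^ 2 := by
        push_cast
        rw [Real.norm_eq_abs, div_pow, sq_abs]
        ring
      rw [h2] at h1
      calc ∫ z, Real.exp (t * (Φ (Fin.cons z D) - m)) ∂P
          = ∫ z, Real.exp (t * (Φ (Fin.cons z D) - Ψ D)) * Real.exp (t * (Ψ D - m)) ∂P := by
            refine integral_congr_ae (ae_of_all _ fun z => ?_)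
            simp only
            rw [← Real.exp_add]
            ring_nf
        _ ≤ _ := by
            rw [integral_mul_const]
            exact mul_le_mul_of_nonneg_right h1 (Real.exp_nonneg _)
    calc _ ≤ ∫ D, Real.exp (c ^ 2 * t ^ 2 / 2) * Real.exp (t * (Ψ D - m))
            ∂(Measure.pi fun _ : Fin n => P) := by
          refine integral_mono ?_ ?_ key
          · exact integrable_of_abs_le _ fun D =>
              abs_integral_le_of_abs_le P fun z => hbound hB m (Fin.cons z D)
          · exact (integrable_of_abs_le _ (hbound hΨB m)).const_mul _
      _ ≤ Real.exp (c ^ 2 * t ^ 2 / 2) * Real.exp (n * c ^ 2 * t ^ 2 / 2) := by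
          rw [integral_const_mul]
          exact mul_le_mul_of_nonneg_left (ih hΨB hΨd) (Real.exp_nonneg _)
      _ = _ := by
          rw [← Real.exp_add]
          push_cast
          ring_nf

theorem measureReal_le_of_bounded_differences (P : Measure Z) [IsProbabilityMeasure P] {n : ℕ}
    {Φ : (Fin n → Z) → ℝ} {B c τ : ℝ} (hB : ∀ D, |Φ D| ≤ B)
    (hd : ∀ D i z, |Φ (Function.update D i z) - Φ D| ≤ c) (hτ : 0 ≤ τ) :
    (Measure.pi fun _ => P).real {D | ∫ D, Φ D ∂(Measure.pi fun _ => P) + τ ≤ Φ D}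
      ≤ Real.exp (-τ ^ 2 / (2 * (n * c ^ 2))) := by
  set m := ∫ D, Φ D ∂(Measure.pi fun _ => P)
  have hs : ProbabilityTheory.HasSubgaussianMGF (fun D => Φ D - m)
      (Real.toNNReal (n * c ^ 2)) (Measure.pi fun _ => P) := by
    refine ⟨fun t => ?_, fun t => ?_⟩
    · refine integrable_of_abs_le _ (B := Real.exp (|t| * (B + |m|))) fun D => ?_
      rw [Real.abs_exp]
      refine Real.exp_le_exp.2 ((le_abs_self _).trans ?_)
      rw [abs_mul]
      exact mul_le_mul_of_nonneg_left ((abs_sub _ _).trans (by linarith [hB D])) (abs_nonneg _)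
    · rw [Real.coe_toNNReal _ (by positivity)]
      exact integral_exp_le_of_bounded_differences P t hB hd
  have := hs.measure_ge_le hτ
  rw [Real.coe_toNNReal _ (by positivity)] at this
  refine le_trans (le_of_eq ?_) this
  congr 1
  ext D
  simp only [Set.mem_ofPred_eq]
  constructor <;> intro h <;> linarith

end Concentration

/-! ### Symmetrization and uniform deviation -/

section Symmetrization

theorem abs_iSup_le_of_abs_le {ι : Type*} [Nonempty ι] {φ : ι → ℝ} {B : ℝ}
    (h : ∀ a, |φ a| ≤ B) : |⨆ a, φ a| ≤ B := by
  obtain ⟨a⟩ := ‹Nonempty ι›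
  have hb : BddAbove (Set.range φ) := ⟨B, by rintro _ ⟨a, rfl⟩; exact (abs_le.1 (h a)).2⟩
  have : Nonempty ι := ⟨a⟩
  exact abs_le.2 ⟨(abs_le.1 (h a)).1.trans (le_ciSup hb a), ciSup_le fun a => (abs_le.1 (h a)).2⟩

theorem bddAbove_range_of_abs_le {ι : Type*} {φ : ι → ℝ} {B : ℝ}
    (h : ∀ a, |φ a| ≤ B) : BddAbove (Set.range φ) :=
  ⟨B, by rintro _ ⟨a, rfl⟩; exact (abs_le.1 (h a)).2⟩

theorem abs_iSup_sub_iSup_le {ι : Type*} [Nonempty ι] {φ ψ : ι → ℝ} {B c : ℝ}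
    (hφ : ∀ a, |φ a| ≤ B) (hψ : ∀ a, |ψ a| ≤ B) (h : ∀ a, |φ a - ψ a| ≤ c) :
    |(⨆ a, φ a) - ⨆ a, ψ a| ≤ c := by
  have h1 : ⨆ a, φ a ≤ (⨆ a, ψ a) + c := ciSup_le fun a => by
    linarith [(abs_le.1 (h a)).2, le_ciSup (bddAbove_range_of_abs_le hψ) a]
  have h2 : ⨆ a, ψ a ≤ (⨆ a, φ a) + c := ciSup_le fun a => by
    linarith [(abs_le.1 (h a)).1, le_ciSup (bddAbove_range_of_abs_le hφ) a]
  exact abs_le.2 ⟨by linarith, by linarith⟩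

theorem abs_sum_le_of_abs_le {n : ℕ} {w : Fin n → ℝ} {B : ℝ} (h : ∀ i, |w i| ≤ B) :
    |∑ i, w i| ≤ n * B :=
  (Finset.abs_sum_le_sum_abs _ _).trans
    ((Finset.sum_le_sum fun i _ => h i).trans (by simp))

theorem abs_intUnit (u : ℤˣ) : |((u : ℤ) : ℝ)| = 1 := by
  rcases Int.units_eq_one_or u with rfl | rfl <;> simp

theorem abs_sign_mul_le {u : ℤˣ} {x B : ℝ} (h : |x| ≤ B) : |((u : ℤ) : ℝ) * x| ≤ B := by
  rwa [abs_mul, abs_intUnit, one_mul]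

variable {Z ι : Type*} {n : ℕ}

/-- The supremum of the signed sums of a family of functions over a sample. -/
noncomputable def signedSup (g : ι → Z → ℝ) (s : Fin n → ℤˣ) (D : Fin n → Z) : ℝ :=
  ⨆ a, ∑ i, ((s i : ℤ) : ℝ) * g a (D i)

/-- The empirical Rademacher complexity of an indexed family of functions. -/
noncomputable def rademacherFamily (g : ι → Z → ℝ) (D : Fin n → Z) : ℝ :=
  (1 / (n : ℝ)) * ((1 / (2 : ℝ) ^ n) * ∑ s : Fin n → ℤˣ, signedSup g s D)

theorem rademacher_eq_rademacherFamily (𝒢 : Set (Z → ℝ)) (D : Fin n → Z) :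
    rademacher 𝒢 D = rademacherFamily (fun a : 𝒢 => (a : Z → ℝ)) D := rfl

/-- The one-sided uniform deviation of the empirical means from the means. -/
noncomputable def deviation [MeasurableSpace Z] (P : Measure Z) (g : ι → Z → ℝ)
    (D : Fin n → Z) : ℝ :=
  ⨆ a, ((∫ z, g a z ∂P) - (1 / (n : ℝ)) * ∑ i, g a (D i))

theorem abs_signedSup_le [Nonempty ι] {g : ι → Z → ℝ} (hg : ∀ a z, |g a z| ≤ 1)
    (s : Fin n → ℤˣ) (D : Fin n → Z) : |signedSup g s D| ≤ n * 1 :=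
  abs_iSup_le_of_abs_le fun _ => abs_sum_le_of_abs_le fun _ => abs_sign_mul_le (hg _ _)

theorem bddAbove_signedSup {g : ι → Z → ℝ} (hg : ∀ a z, |g a z| ≤ 1)
    (s : Fin n → ℤˣ) (D : Fin n → Z) :
    BddAbove (Set.range fun a => ∑ i, ((s i : ℤ) : ℝ) * g a (D i)) :=
  bddAbove_range_of_abs_le fun _ => abs_sum_le_of_abs_le fun _ => abs_sign_mul_le (hg _ _)

theorem rademacherFamily_comp_le {κ : Type*} [Nonempty ι] {g : κ → Z → ℝ}
    (hg : ∀ a z, |g a z| ≤ 1) (e : ι → κ) (D : Fin n → Z) :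
    rademacherFamily (fun a => g (e a)) D ≤ rademacherFamily g D := by
  refine mul_le_mul_of_nonneg_left (mul_le_mul_of_nonneg_left
    (Finset.sum_le_sum fun s _ => ciSup_le fun a => ?_) (by positivity)) (by positivity)
  exact le_ciSup (bddAbove_signedSup hg s D) (e a)

/-- Multiplying a family by a mean of two sign functions does not increase the Rademacher
complexity. -/
theorem rademacherFamily_mul_le [Nonempty ι] {g : ι → Z → ℝ} (hg : ∀ a z, |g a z| ≤ 1)
    (u v : Z → ℤˣ) (D : Fin n → Z) :
    rademacherFamily (fun a z => ((((u z : ℤ) : ℝ) + ((v z : ℤ) : ℝ)) / 2) * g a z) D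
      ≤ rademacherFamily g D := by
  refine mul_le_mul_of_nonneg_left (mul_le_mul_of_nonneg_left ?_ (by positivity)) (by positivity)
  -- For a fixed sample, multiplication by the signs `u (D i)` permutes the sign vectors. The bound
  -- then follows from convexity of the supremum.
  have hsum : ∀ u : Z → ℤˣ, ∑ s : Fin n → ℤˣ, signedSup g (s * fun i => u (D i)) D
      = ∑ s : Fin n → ℤˣ, signedSup g s D := fun u =>
    Equiv.sum_comp (Equiv.mulRight fun i => u (D i)) fun s => signedSup g s D
  have h : ∀ s : Fin n → ℤˣ,
      signedSup (fun a z => ((((u z : ℤ) : ℝ) + ((v z : ℤ) : ℝ)) / 2) * g a z) s D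
      ≤ 1 / 2 * signedSup g (s * fun i => u (D i)) D
        + 1 / 2 * signedSup g (s * fun i => v (D i)) D := by
    intro s
    refine ciSup_le fun a => ?_
    have h1 := le_ciSup (bddAbove_signedSup hg (s * fun i => u (D i)) D) a
    have h2 := le_ciSup (bddAbove_signedSup hg (s * fun i => v (D i)) D) a
    refine le_trans (le_of_eq ?_) (add_le_add (mul_le_mul_of_nonneg_left h1 (by norm_num))
      (mul_le_mul_of_nonneg_left h2 (by norm_num)))
    simp only
    rw [Finset.mul_sum, Finset.mul_sum, ← Finset.sum_add_distrib]
    refine Finset.sum_congr rfl fun i _ => ?_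
    simp only [Pi.mul_apply, Units.val_mul, Int.cast_mul]
    ring
  refine (Finset.sum_le_sum fun s _ => h s).trans ?_
  rw [Finset.sum_add_distrib, ← Finset.mul_sum, ← Finset.mul_sum, hsum, hsum]
  linarith

variable [MeasurableSpace Z]

theorem abs_deviation_term_le (P : Measure Z) [IsProbabilityMeasure P] {f : Z → ℝ}
    (hf : ∀ z, |f z| ≤ 1) (D : Fin n → Z) :
    |(∫ z, f z ∂P) - (1 / (n : ℝ)) * ∑ i, f (D i)| ≤ 2 := by
  have h1 := abs_integral_le_of_abs_le P hf
  have h2 : |(1 / (n : ℝ)) * ∑ i, f (D i)| ≤ 1 := by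
    rw [abs_mul, abs_of_nonneg (by positivity)]
    rcases Nat.eq_zero_or_pos n with rfl | hn
    · simp
    · refine (mul_le_mul_of_nonneg_left (abs_sum_le_of_abs_le fun i => hf (D i))
        (by positivity)).trans (le_of_eq ?_)
      field_simp
  exact (abs_sub _ _).trans (by linarith)

theorem le_deviation (P : Measure Z) [IsProbabilityMeasure P] {g : ι → Z → ℝ}
    (hg : ∀ a z, |g a z| ≤ 1) (D : Fin n → Z) (a : ι) :
    (∫ z, g a z ∂P) - (1 / (n : ℝ)) * ∑ i, g a (D i) ≤ deviation P g D :=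
  le_ciSup (f := fun a => (∫ z, g a z ∂P) - (1 / (n : ℝ)) * ∑ i, g a (D i))
    (bddAbove_range_of_abs_le fun a => abs_deviation_term_le P (hg a) D) a

theorem abs_deviation_le [Nonempty ι] (P : Measure Z) [IsProbabilityMeasure P] {g : ι → Z → ℝ}
    (hg : ∀ a z, |g a z| ≤ 1) (D : Fin n → Z) : |deviation P g D| ≤ 2 :=
  abs_iSup_le_of_abs_le fun a => abs_deviation_term_le P (hg a) D

theorem abs_deviation_update_sub_le [Nonempty ι] (P : Measure Z) [IsProbabilityMeasure P]
    {g : ι → Z → ℝ} (hg : ∀ a z, |g a z| ≤ 1) (D : Fin n → Z) (i : Fin n) (z : Z) :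
    |deviation P g (Function.update D i z) - deviation P g D| ≤ 2 / n := by
  refine abs_iSup_sub_iSup_le (fun a => abs_deviation_term_le P (hg a) _)
    (fun a => abs_deviation_term_le P (hg a) D) fun a => ?_
  have h : ∑ j, g a (Function.update D i z j) - ∑ j, g a (D j) = g a z - g a (D i) := by
    rw [← Finset.sum_sub_distrib, Finset.sum_eq_single i]
    · simp
    · intro j _ hj
      simp [Function.update_of_ne hj]
    · simp
  rw [sub_sub_sub_cancel_left, ← mul_sub, ← neg_sub (∑ j, g a (Function.update D i z j)), h,
    abs_mul, abs_neg, abs_of_nonneg (by positivity : (0 : ℝ) ≤ 1 / n), one_div, div_eq_inv_mul]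
  refine mul_le_mul_of_nonneg_left ?_ (by positivity)
  exact (abs_sub _ _).trans (by linarith [hg a z, hg a (D i)])

variable [Countable Z] [DiscreteMeasurableSpace Z]

/-- The map is an involution, so the preimage of a singleton is a singleton, and its mass is a
reordering of the same product. Countability makes singletons enough. -/
theorem measurePreserving_swap_coordinates (P : Measure Z) [IsProbabilityMeasure P]
    (s : Fin n → ℤˣ) :
    MeasurePreserving (fun x : (Fin n → Z) × (Fin n → Z) =>
        ((fun i => if s i = 1 then x.1 i else x.2 i), fun i => if s i = 1 then x.2 i else x.1 i))
      ((Measure.pi fun _ => P).prod (Measure.pi fun _ => P))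
      ((Measure.pi fun _ => P).prod (Measure.pi fun _ => P)) := by
  refine ⟨.of_discrete, Measure.ext_of_singleton fun x => ?_⟩
  rw [Measure.map_apply .of_discrete .of_discrete]
  have : (fun x : (Fin n → Z) × (Fin n → Z) =>
      ((fun i => if s i = 1 then x.1 i else x.2 i), fun i => if s i = 1 then x.2 i else x.1 i)) ⁻¹'
        {x} = {((fun i => if s i = 1 then x.1 i else x.2 i),
          fun i => if s i = 1 then x.2 i else x.1 i)} := by
    ext y
    simp only [Set.mem_preimage, Set.mem_singleton_iff]
    constructor
    · rintro rfl
      ext i <;> by_cases h : s i = 1 <;> simp [h]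
    · rintro rfl
      ext i <;> by_cases h : s i = 1 <;> simp [h]
  rw [this]
  obtain ⟨a, b⟩ := x
  simp only [← Set.singleton_prod_singleton, Measure.prod_prod, Measure.pi_singleton]
  rw [← Finset.prod_mul_distrib, ← Finset.prod_mul_distrib]
  refine Finset.prod_congr rfl fun i _ => ?_
  by_cases h : s i = 1 <;> simp [h, mul_comm]

/-- **Symmetrization**: the expected one-sided uniform deviation is at most twice the expected
Rademacher complexity. -/
theorem integral_deviation_le [Nonempty ι] (P : Measure Z) [IsProbabilityMeasure P]
    {g : ι → Z → ℝ} (hg : ∀ a z, |g a z| ≤ 1) (hn : 0 < n) :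
    ∫ D, deviation P g D ∂(Measure.pi fun _ : Fin n => P)
      ≤ 2 * ∫ D, rademacherFamily g D ∂(Measure.pi fun _ : Fin n => P) := by
  set μ : Measure (Fin n → Z) := Measure.pi fun _ => P
  have hn' : (0 : ℝ) < n := by exact_mod_cast hn
  set A : (Fin n → ℤˣ) → (Fin n → Z) × (Fin n → Z) → ℝ := fun s x =>
    ⨆ a, ∑ i, ((s i : ℤ) : ℝ) * (g a (x.2 i) - g a (x.1 i)) with hA
  have hAterm : ∀ (s : Fin n → ℤˣ) (x : (Fin n → Z) × (Fin n → Z)) a,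
      |∑ i, ((s i : ℤ) : ℝ) * (g a (x.2 i) - g a (x.1 i))| ≤ n * 2 :=
    fun s x a => abs_sum_le_of_abs_le fun i => abs_sign_mul_le
      ((abs_sub _ _).trans (by linarith [hg a (x.2 i), hg a (x.1 i)]))
  have hAB : ∀ s x, |A s x| ≤ n * 2 := fun s x => abs_iSup_le_of_abs_le (hAterm s x)
  have hint : ∀ s, Integrable (A s) (μ.prod μ) := fun s => integrable_of_abs_le _ (hAB s)
  have hSint : ∀ s, Integrable (signedSup g s) μ := fun s =>
    integrable_of_abs_le _ (abs_signedSup_le hg s)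
  -- Exchanging the two samples at the coordinates with `s i = -1` flips exactly those differences.
  have hswap : ∀ s, ∫ x, A s x ∂(μ.prod μ) = ∫ x, A 1 x ∂(μ.prod μ) := by
    intro s
    have h := measurePreserving_swap_coordinates P s
    calc ∫ x, A s x ∂(μ.prod μ) = ∫ x, A 1 ((fun i => if s i = 1 then x.1 i else x.2 i),
          fun i => if s i = 1 then x.2 i else x.1 i) ∂(μ.prod μ) := by
          refine integral_congr_ae (ae_of_all _ fun x => ?_)
          refine iSup_congr fun a => Finset.sum_congr rfl fun i _ => ?_
          rcases Int.units_eq_one_or (s i) with h | h <;> simp [h]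
      _ = ∫ x, A 1 x ∂(μ.prod μ) := by
          conv_rhs => rw [← h.map_eq]
          rw [integral_map h.measurable.aemeasurable
            (Measurable.of_discrete).aestronglyMeasurable]
  have hle : ∀ s, ∫ x, A s x ∂(μ.prod μ)
      ≤ ∫ D, signedSup g s D ∂μ + ∫ D, signedSup g (-s) D ∂μ := by
    intro s
    have h2 : ∫ x : (Fin n → Z) × (Fin n → Z), signedSup g s x.2 ∂(μ.prod μ)
        = ∫ D, signedSup g s D ∂μ := by
      simpa using integral_fun_snd (μ := μ) (ν := μ) (signedSup g s)
    have h1 : ∫ x : (Fin n → Z) × (Fin n → Z), signedSup g (-s) x.1 ∂(μ.prod μ)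
        = ∫ D, signedSup g (-s) D ∂μ := by
      simpa using integral_fun_fst (μ := μ) (ν := μ) (signedSup g (-s))
    rw [← h1, ← h2, ← integral_add ((hSint s).comp_snd μ) ((hSint (-s)).comp_fst μ)]
    refine integral_mono (hint s) (((hSint s).comp_snd μ).add ((hSint (-s)).comp_fst μ))
      fun x => ciSup_le fun a => ?_
    refine le_trans (le_of_eq ?_) (add_le_add (le_ciSup (bddAbove_signedSup hg s x.2) a)
      (le_ciSup (bddAbove_signedSup hg (-s) x.1) a))
    simp only [← Finset.sum_add_distrib]
    refine Finset.sum_congr rfl fun i _ => ?_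
    simp only [Pi.neg_apply, Units.val_neg, Int.cast_neg]
    ring
  -- The true mean is the expected average over a ghost sample `D'`, and a supremum of expectations
  -- is at most the expectation of the supremum.
  have hdev : ∀ D, n * deviation P g D ≤ ∫ D', A 1 (D, D') ∂μ := by
    intro D
    rw [← le_div_iff₀' hn']
    refine ciSup_le fun a => ?_
    rw [le_div_iff₀' hn', mul_sub, ← mul_assoc, mul_one_div_cancel hn'.ne', one_mul]
    have h1 : ∀ i : Fin n, ∫ D', g a (D' i) ∂μ = ∫ z, g a z ∂P := by
      intro i
      have h := measurePreserving_eval (fun _ : Fin n => P) i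
      rw [← h.map_eq, integral_map h.measurable.aemeasurable
            (Measurable.of_discrete).aestronglyMeasurable]
    have h2 : ∀ i : Fin n, Integrable (fun D' : Fin n → Z => g a (D' i)) μ := fun i =>
      integrable_of_abs_le _ (B := 1) fun D' => hg _ _
    calc n * ∫ z, g a z ∂P - ∑ i, g a (D i) = ∫ D', ∑ i, (g a (D' i) - g a (D i)) ∂μ := by
          rw [integral_finsetSum (f := fun i (D' : Fin n → Z) => g a (D' i) - g a (D i)) _
            fun i _ => (h2 i).sub (integrable_const _)]
          simp_rw [integral_sub (h2 _) (integrable_const _), h1]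
          simp
      _ ≤ _ := by
          refine integral_mono (integrable_of_abs_le _ (B := n * 2) fun D' => ?_)
            (integrable_of_abs_le _ fun D' => hAB 1 (D, D')) fun D' => ?_
          · simpa using hAterm 1 (D, D') a
          · simpa [hA] using le_ciSup (bddAbove_range_of_abs_le (hAterm 1 (D, D'))) a
  have hdevint : n * ∫ D, deviation P g D ∂μ ≤ ∫ x, A 1 x ∂(μ.prod μ) := by
    rw [integral_prod _ (hint 1), ← integral_const_mul]
    exact integral_mono ((integrable_of_abs_le _ (abs_deviation_le P hg)).const_mul _)
      (integrable_of_abs_le _ fun D => abs_integral_le_of_abs_le _ fun D' => hAB 1 (D, D')) hdev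
  have hcard : (Fintype.card (Fin n → ℤˣ) : ℝ) = 2 ^ n := by simp
  have hneg : ∑ s : Fin n → ℤˣ, ∫ D, signedSup g (-s) D ∂μ
      = ∑ s : Fin n → ℤˣ, ∫ D, signedSup g s D ∂μ :=
    Equiv.sum_comp (Equiv.neg (Fin n → ℤˣ)) fun s => ∫ D, signedSup g s D ∂μ
  have hfin : 2 ^ n * ∫ x, A 1 x ∂(μ.prod μ) ≤ 2 * ∑ s : Fin n → ℤˣ, ∫ D, signedSup g s D ∂μ := by
    calc 2 ^ n * ∫ x, A 1 x ∂(μ.prod μ) = ∑ s : Fin n → ℤˣ, ∫ x, A s x ∂(μ.prod μ) := by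
          simp_rw [hswap]
          simp
      _ ≤ _ := (Finset.sum_le_sum fun s _ => hle s).trans (by
          rw [Finset.sum_add_distrib, hneg, two_mul])
  have hrad : ∫ D, rademacherFamily g D ∂μ
      = 1 / (n : ℝ) * (1 / 2 ^ n * ∑ s : Fin n → ℤˣ, ∫ D, signedSup g s D ∂μ) := by
    unfold rademacherFamily
    rw [integral_const_mul, integral_const_mul, integral_finsetSum _ fun s _ => hSint s]
  rw [hrad]
  have h2n : (0 : ℝ) < 2 ^ n := by positivity
  have h3 : 2 ^ n * (n * ∫ D, deviation P g D ∂μ)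
      ≤ 2 * ∑ s : Fin n → ℤˣ, ∫ D, signedSup g s D ∂μ :=
    (mul_le_mul_of_nonneg_left hdevint h2n.le).trans hfin
  rw [← le_div_iff₀' h2n, ← le_div_iff₀' hn'] at h3
  refine h3.trans (le_of_eq ?_)
  field_simp

/-- A uniform deviation inequality in terms of the Rademacher complexity. -/
theorem measureReal_le_deviation_le [Nonempty ι] (P : Measure Z) [IsProbabilityMeasure P]
    {g : ι → Z → ℝ} (hg : ∀ a z, |g a z| ≤ 1) (hn : 0 < n) {ε δ : ℝ} (hδ : 0 < δ)
    (hR : ∫ D, rademacherFamily g D ∂(Measure.pi fun _ : Fin n => P)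
        + Real.sqrt (2 * Real.log (8 / δ) / n) < ε / 2) :
    (Measure.pi fun _ : Fin n => P).real {D | ε ≤ deviation P g D} ≤ δ / 8 := by
  -- For `δ ≥ 8` the bound exceeds `1`; otherwise the logarithm is nonnegative.
  rcases le_or_gt 8 δ with h8 | h8
  · exact measureReal_le_one.trans (by linarith)
  have hn' : (0 : ℝ) < n := by exact_mod_cast hn
  set L := Real.log (8 / δ)
  have hL : 0 ≤ L := Real.log_nonneg (by rw [le_div_iff₀ hδ]; linarith)
  set m := ∫ D, deviation P g D ∂(Measure.pi fun _ : Fin n => P)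
  have hm := integral_deviation_le P hg hn
  have hτ : 2 * Real.sqrt (2 * L / n) ≤ ε - m := by linarith
  have hτ0 : 0 ≤ ε - m := (by positivity : 0 ≤ 2 * Real.sqrt (2 * L / n)).trans hτ
  -- One coordinate moves the deviation by at most `2 / n`, so the tail at `τ = ε - m` is `exp (-n τ
  -- ^ 2 / 8)`; this inequality makes it at most `exp (-L) = δ / 8`.
  have hsq : 8 * L / n ≤ (ε - m) ^ 2 := by
    have := pow_le_pow_left₀ (by positivity) hτ 2
    rw [mul_pow, Real.sq_sqrt (by positivity)] at this
    refine le_trans (le_of_eq ?_) this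
    ring
  have h := measureReal_le_of_bounded_differences P (n := n) (abs_deviation_le P hg)
    (abs_deviation_update_sub_le P hg) hτ0
  rw [add_sub_cancel] at h
  refine h.trans ?_
  have : Real.exp (-L) = δ / 8 := by
    rw [Real.exp_neg, Real.exp_log (by positivity), inv_div]
  rw [← this, Real.exp_le_exp, neg_div, neg_le_neg_iff, le_div_iff₀ (by positivity)]
  refine le_trans (le_of_eq ?_) hsq
  field_simp
  ring

end Symmetrization

/-! ### Lower convex hulls and supporting lines -/

section Hull

/-- A set of points of the right half plane that lie on a nondecreasing `1`-Lipschitz graph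
through the origin. -/
structure IsLipschitzGraph (A : Set (ℝ × ℝ)) : Prop where
  zero_mem : (0, 0) ∈ A
  fst_nonneg : ∀ p ∈ A, 0 ≤ p.1
  monotone : ∀ p ∈ A, ∀ q ∈ A, p.1 ≤ q.1 → p.2 ≤ q.2
  lipschitz : ∀ p ∈ A, ∀ q ∈ A, p.1 ≤ q.1 → q.2 - p.2 ≤ q.1 - p.1

variable {A : Set (ℝ × ℝ)} {x y m c : ℝ}

theorem le_of_mem_convexHull (h : ∀ p ∈ A, m + c * p.1 ≤ p.2) (hxy : (x, y) ∈ convexHull ℝ A) :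
    m + c * x ≤ y := by
  have hconv : Convex ℝ {p : ℝ × ℝ | m + c * p.1 ≤ p.2} := by
    intro p hp q hq a b ha hb hab
    simp only [Set.mem_ofPred_eq, Prod.fst_add, Prod.snd_add, Prod.smul_fst, Prod.smul_snd,
      smul_eq_mul] at *
    have h1 := mul_le_mul_of_nonneg_left hp ha
    have h2 := mul_le_mul_of_nonneg_left hq hb
    have h3 : m = a * m + b * m := by rw [← add_mul, hab, one_mul]
    linarith
  exact convexHull_min h hconv hxy

/-- The point `(x, y)` rules out an empty fibre, over which `sInf` would take the default value `0`.
-/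
theorem le_lowerHull (h : ∀ p ∈ A, m + c * p.1 ≤ p.2) (hxy : (x, y) ∈ convexHull ℝ A) :
    m + c * x ≤ lowerHull A x :=
  le_csInf ⟨y, hxy⟩ fun _ hy => le_of_mem_convexHull h hy

theorem IsLipschitzGraph.snd_nonneg (hA : IsLipschitzGraph A) : ∀ p ∈ A, 0 ≤ p.2 :=
  fun p hp => hA.monotone _ hA.zero_mem p hp (hA.fst_nonneg p hp)

theorem IsLipschitzGraph.lowerHull_le (hA : IsLipschitzGraph A) (hxy : (x, y) ∈ convexHull ℝ A) :
    lowerHull A x ≤ y := by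
  refine csInf_le ⟨0, fun z hz => ?_⟩ hxy
  simpa using le_of_mem_convexHull (m := 0) (c := 0)
    (fun p hp => by simpa using hA.snd_nonneg p hp) hz

/-- The lower boundary of the convex hull has a supporting line with slope in `[0, 1]` at the
abscissa of each point of the graph. -/
theorem IsLipschitzGraph.exists_supporting_line (hA : IsLipschitzGraph A) (hx : (x, y) ∈ A) :
    ∃ c : ℝ, 0 ≤ c ∧ c ≤ 1 ∧ ∀ p ∈ A, lowerHull A x + c * (p.1 - x) ≤ p.2 := by
  set v := lowerHull A x
  have hvy : v ≤ y := hA.lowerHull_le (subset_convexHull ℝ A hx)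
  -- The slope is the supremum of the slopes from points on the left to `(x, v)`. Inserting `0`
  -- keeps `T` nonempty and the slope nonnegative; no attainment of the infimum `v` is needed.
  set T : Set ℝ := insert 0 {c | ∃ p ∈ A, p.1 < x ∧ c = (v - p.2) / (x - p.1)}
  have hT1 : ∀ c ∈ T, c ≤ 1 := by
    rintro c (rfl | ⟨p, hp, hpx, rfl⟩)
    · exact zero_le_one
    · rw [div_le_one (by linarith)]
      linarith [hA.lipschitz p hp _ hx hpx.le]
  have hbdd : BddAbove T := ⟨1, hT1⟩
  have h0 : (0 : ℝ) ∈ T := Set.mem_insert _ _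
  refine ⟨sSup T, le_csSup hbdd h0, csSup_le ⟨0, h0⟩ hT1, fun q hq => ?_⟩
  rcases lt_trichotomy q.1 x with hqx | hqx | hqx
  · have h : (v - q.2) / (x - q.1) ≤ sSup T := le_csSup hbdd (Or.inr ⟨q, hq, hqx, rfl⟩)
    rw [div_le_iff₀ (by linarith)] at h
    linarith
  · rw [hqx, sub_self, mul_zero, add_zero]
    exact hvy.trans (hA.monotone _ hx q hq hqx.ge)
  · have h : sSup T ≤ (q.2 - v) / (q.1 - x) := by
      refine csSup_le ⟨0, h0⟩ ?_
      rintro c (rfl | ⟨p, hp, hpx, rfl⟩)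
      · exact div_nonneg (by linarith [hA.monotone _ hx q hq hqx.le]) (by linarith)
      · have hd : 0 < q.1 - p.1 := by linarith
        -- The chord from `p` to `q` passes over `x` within the hull, hence not below `v`; so left
        -- slopes never exceed right slopes.
        have hmem : (x, (q.1 - x) / (q.1 - p.1) * p.2 + (x - p.1) / (q.1 - p.1) * q.2)
            ∈ convexHull ℝ A := by
          have h1 := convex_convexHull ℝ A (subset_convexHull ℝ A hp) (subset_convexHull ℝ A hq)
            (div_nonneg (by linarith : 0 ≤ q.1 - x) hd.le)
            (div_nonneg (by linarith : 0 ≤ x - p.1) hd.le)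
            (by field_simp; ring)
          convert h1 using 1
          ext
          · simp only [Prod.fst_add, Prod.smul_fst, smul_eq_mul]
            field_simp
            ring
          · simp
        have h2 := hA.lowerHull_le hmem
        have h3 : v * (q.1 - p.1) ≤ (q.1 - x) * p.2 + (x - p.1) * q.2 := by
          rw [← le_div_iff₀ hd]
          refine h2.trans (le_of_eq ?_)
          ring
        rw [div_le_div_iff₀ (by linarith) (by linarith)]
        linarith
    rw [le_div_iff₀ (by linarith)] at h
    linarith

end Hull

/-! ### The empirical curve and the kinks of its hull -/

section Labels

variable {n : ℕ} (y : Fin n → ℤˣ)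

theorem cumLabels_zero : cumLabels y 0 = 0 := by simp [cumLabels]

theorem cumLabels_mono {j k : ℕ} (h : j ≤ k) : cumLabels y j ≤ cumLabels y k := by
  refine Finset.sum_le_sum fun i _ => ?_
  split_ifs with h1 h2
  · exact le_rfl
  · exact absurd ⟨h1.1.trans_le h, h1.2⟩ h2
  · exact zero_le_one
  · exact le_rfl

theorem sum_ite_val_lt {k : ℕ} (hk : k ≤ n) (a : ℕ → ℝ) :
    ∑ i : Fin n, (if (i : ℕ) < k then a i else 0) = ∑ i ∈ Finset.range k, a i := by
  rw [Fin.sum_univ_eq_sum_range (fun i => if i < k then a i else 0) n, ← Finset.sum_filter]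
  congr 1
  ext i
  simp only [Finset.mem_filter, Finset.mem_range]
  omega

theorem cumLabels_sub_le {j k : ℕ} (h : j ≤ k) (hk : k ≤ n) :
    cumLabels y k - cumLabels y j ≤ (k : ℝ) - j := by
  have hcount : ∀ l ≤ n, ∑ i : Fin n, (if (i : ℕ) < l then (1 : ℝ) else 0) = l := fun l hl => by
    rw [sum_ite_val_lt hl fun _ => 1]
    simp
  rw [← hcount k hk, ← hcount j (h.trans hk), cumLabels, cumLabels, ← Finset.sum_sub_distrib,
    ← Finset.sum_sub_distrib]
  refine Finset.sum_le_sum fun i _ => ?_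
  by_cases hy : y i = 1
  · simp [hy]
  · simp only [hy, and_false, if_false, sub_self, sub_nonneg]
    split_ifs with h1 h2
    · exact le_rfl
    · exact absurd (h1.trans_le h) h2
    · exact zero_le_one
    · exact le_rfl

theorem isLipschitzGraph_points : IsLipschitzGraph (points y) where
  zero_mem := ⟨0, Nat.zero_le _, by simp [cumLabels_zero]⟩
  fst_nonneg := by
    rintro _ ⟨k, _, rfl⟩
    exact Nat.cast_nonneg k
  monotone := by
    rintro _ ⟨j, _, rfl⟩ _ ⟨k, _, rfl⟩ h
    exact cumLabels_mono y (Nat.cast_le.1 h)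
  lipschitz := by
    rintro _ ⟨j, _, rfl⟩ _ ⟨k, hk, rfl⟩ h
    exact cumLabels_sub_le y (Nat.cast_le.1 h) hk

theorem mem_points {k : ℕ} (hk : k ≤ n) : ((k : ℝ), cumLabels y k) ∈ points y := ⟨k, hk, rfl⟩

theorem hullHeight_le {k : ℕ} (hk : k ≤ n) : hullHeight y k ≤ cumLabels y k :=
  (isLipschitzGraph_points y).lowerHull_le (subset_convexHull ℝ _ (mem_points y hk))

theorem le_hullHeight {m c : ℝ} (h : ∀ j ≤ n, m + c * j ≤ cumLabels y j) {k : ℕ} (hk : k ≤ n) :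
    m + c * k ≤ hullHeight y k := by
  refine le_lowerHull ?_ (subset_convexHull ℝ _ (mem_points y hk))
  rintro _ ⟨j, hj, rfl⟩
  exact h j hj

theorem hullHeight_zero : hullHeight y 0 = 0 :=
  le_antisymm ((hullHeight_le y (Nat.zero_le _)).trans (cumLabels_zero y).le) (by
    simpa using le_hullHeight y (m := 0) (c := 0)
      (fun j _ => by simpa [cumLabels_zero] using cumLabels_mono y (Nat.zero_le j))
      (Nat.zero_le n))

/-- An affine minorant of the cumulative labels only has to be checked at the end points and
where the slope of the hull increases. -/
theorem le_cumLabels_of_kinks {m c : ℝ} (h0 : m + c * (0 : ℕ) ≤ cumLabels y 0)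
    (hn : m + c * n ≤ cumLabels y n)
    (hkink : ∀ j, j + 1 < n →
      hullHeight y (j + 1) - hullHeight y j < hullHeight y (j + 2) - hullHeight y (j + 1) →
      m + c * (j + 1 : ℕ) ≤ cumLabels y (j + 1)) :
    ∀ j ≤ n, m + c * j ≤ cumLabels y j := by
  classical
  -- It suffices to test the line at the least minimiser `k` of `S_j - c j`. If `k` is interior, it
  -- turns out to be a kink.
  obtain ⟨j₀, hj₀, hmin⟩ := Finset.exists_min_image (Finset.range (n + 1))
    (fun j : ℕ => cumLabels y j - c * j) ⟨0, by simp⟩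
  have hex : ∃ j, j ≤ n ∧ cumLabels y j - c * j ≤ cumLabels y j₀ - c * j₀ :=
    ⟨j₀, by simpa [Nat.lt_succ_iff] using hj₀, le_rfl⟩
  set k := Nat.find hex with hk
  obtain ⟨hkn, hkle⟩ := Nat.find_spec hex
  rw [← hk] at hkn hkle
  have hkmin : ∀ j ≤ n, cumLabels y k - c * k ≤ cumLabels y j - c * j := fun j hj =>
    hkle.trans (hmin j (by simpa [Nat.lt_succ_iff] using hj))
  have hklt : ∀ j < k, cumLabels y k - c * k < cumLabels y j - c * j := fun j hj => by
    have := Nat.find_min hex hj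
    push Not at this
    exact hkle.trans_lt (this (by omega))
  suffices hS : m + c * k ≤ cumLabels y k by
    intro j hj
    linarith [hkmin j hj]
  rcases Nat.eq_zero_or_pos k with hk0 | hk0
  · rw [hk0]; exact h0
  rcases hkn.eq_or_lt with hkn' | hkn'
  · rw [hkn']; exact hn
  obtain ⟨l, hl⟩ : ∃ l, k = l + 1 := ⟨k - 1, by omega⟩
  rw [hl]
  refine hkink l (by omega) ?_
  obtain ⟨i, hi, hmax⟩ := Finset.exists_max_image (Finset.range k)
    (fun j : ℕ => (cumLabels y k - cumLabels y j) / ((k : ℝ) - j)) ⟨0, by simpa using hk0⟩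
  set c' := (cumLabels y k - cumLabels y i) / ((k : ℝ) - i)
  have hpos : ∀ j < k, (0 : ℝ) < (k : ℝ) - j := fun j hj => by
    have : (j : ℝ) < k := by exact_mod_cast hj
    linarith
  have hc' : c' < c := by
    rw [Finset.mem_range] at hi
    rw [div_lt_iff₀ (hpos i hi)]
    linarith [hklt i hi]
  -- As `k` is the least minimiser, every left slope is strictly below `c`. Lines of slopes `c' < c`
  -- thus both support the curve at `k`, so the hull increment is at most `c'` before `k` and at
  -- least `c` after it.
  have hline : ∀ j ≤ n, cumLabels y k - c' * k + c' * j ≤ cumLabels y j := by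
    intro j hj
    rcases lt_or_ge j k with hjk | hjk
    · have := hmax j (Finset.mem_range.2 hjk)
      rw [div_le_iff₀ (hpos j hjk)] at this
      linarith
    · have h1 : (k : ℝ) ≤ j := by exact_mod_cast hjk
      have h2 := mul_le_mul_of_nonneg_right hc'.le (sub_nonneg.2 h1)
      linarith [hkmin j hj]
  have h1 := le_hullHeight y hline (k := l) (by omega)
  have h2 := le_hullHeight y (m := cumLabels y k - c * k) (c := c)
    (fun j hj => by linarith [hkmin j hj]) (k := l + 2) (by omega)
  have h3 := hullHeight_le y hkn
  rw [hl] at h1 h2 h3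
  push_cast at h1 h2
  linarith

end Labels

/-! ### From intervals to monotone functions of the score -/

section LayerCake

/-- By monotonicity and continuity the sublevel set is a compact initial segment, so it has a
greatest element unless empty; then `-1` lies below all scores. -/
theorem exists_threshold {g : I → I} (hg : Continuous g) (hm : Monotone g) (u : ℝ) :
    ∃ p : ℝ, ∀ x : I, (x : ℝ) ≤ p ↔ (g x : ℝ) ≤ u := by
  set K : Set I := {x | (g x : ℝ) ≤ u}
  have hK : IsCompact K := (isClosed_le (by fun_prop) continuous_const).isCompact
  rcases K.eq_empty_or_nonempty with he | hne
  · refine ⟨-1, fun x => ⟨fun h => ?_, fun h => ?_⟩⟩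
    · linarith [x.2.1]
    · have : x ∈ K := h
      rw [he] at this
      exact this.elim
  · obtain ⟨p, hp, hmax⟩ := hK.exists_isGreatest hne
    exact ⟨p, fun x => ⟨fun h => (Subtype.coe_le_coe.2 (hm (Subtype.coe_le_coe.1 h))).trans hp,
      fun h => hmax h⟩⟩

theorem integral_ite_lt {a : ℝ} (h0 : 0 ≤ a) (h1 : a ≤ 1) :
    ∫ u in Set.Ioc (0 : ℝ) 1, (if u < a then (1 : ℝ) else 0) = a := by
  have : (fun u : ℝ => if u < a then (1 : ℝ) else 0) = (Set.Iio a).indicator fun _ => 1 := by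
    ext u
    simp [Set.indicator_apply]
  rw [this, integral_indicator measurableSet_Iio, Measure.restrict_restrict measurableSet_Iio]
  have hae : (Set.Iio a ∩ Set.Ioc (0 : ℝ) 1 : Set ℝ) =ᵐ[volume] Set.Ioc 0 a := by
    have : Set.Iio a ∩ Set.Ioc (0 : ℝ) 1 = Set.Ioo 0 a := by
      ext u
      simp only [Set.mem_inter_iff, Set.mem_Iio, Set.mem_Ioc, Set.mem_Ioo]
      constructor
      · rintro ⟨h, h', -⟩; exact ⟨h', h⟩
      · rintro ⟨h, h'⟩; exact ⟨h', h, by linarith⟩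
    rw [this]
    exact Ioo_ae_eq_Ioc
  rw [Measure.restrict_congr_set hae]
  simp [h0]

variable {Z : Type*} [Countable Z] [MeasurableSpace Z] [DiscreteMeasurableSpace Z] {n : ℕ}

/-- If the empirical probabilities of all intervals of scores are accurate up to `ε`, then so
are the empirical means of truncated monotone functions of the score, shifted by a constant. -/
theorem abs_integral_sub_average_le (P : Measure Z) [IsProbabilityMeasure P] (f : Z → I)
    (D : Fin n → Z) {ε : ℝ}
    (hD : ∀ p₁ p₂ : ℝ, |(∫ z, (if p₁ < (f z : ℝ) ∧ (f z : ℝ) ≤ p₂ then (1 : ℝ) else 0) ∂P)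
      - (1 / (n : ℝ)) * ∑ i, (if p₁ < (f (D i) : ℝ) ∧ (f (D i) : ℝ) ≤ p₂ then (1 : ℝ) else 0)| ≤ ε)
    {g : I → I} (hg : Continuous g) (hm : Monotone g) {c : ℝ} (h0 : 0 ≤ c) (h1 : c ≤ 1) (t : ℝ) :
    |(∫ z, (if (f z : ℝ) ≤ t then (g (f z) : ℝ) - c else 0) ∂P)
      - (1 / (n : ℝ)) * ∑ i, (if (f (D i) : ℝ) ≤ t then (g (f (D i)) : ℝ) - c else 0)| ≤ ε := by
  set ν : Measure ℝ := volume.restrict (Set.Ioc (0 : ℝ) 1)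
  have hν : IsProbabilityMeasure ν := ⟨by simp [ν]⟩
  -- Layer cake: integrating over `u` in `(0, 1]` gives `g - c` on `{f ≤ t}`.
  set φ : ℝ → Z → ℝ := fun u z =>
    if (f z : ℝ) ≤ t then (if u < (g (f z) : ℝ) then 1 else 0) - (if u < c then 1 else 0) else 0
    with hφ
  have hstep : ∀ a : ℝ, Integrable (fun u : ℝ => if u < a then (1 : ℝ) else 0) ν := fun a =>
    Integrable.of_bound (Measurable.ite measurableSet_Iio measurable_const
      measurable_const).aestronglyMeasurable 1 (ae_of_all _ fun u => by split_ifs <;> simp)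
  have hφint : ∀ z, Integrable (fun u => φ u z) ν := fun z => by
    by_cases h : (f z : ℝ) ≤ t
    · simp only [hφ, h, if_true]
      exact (hstep _).sub (hstep _)
    · simp [hφ, h]
  have hψ : ∀ z, (if (f z : ℝ) ≤ t then (g (f z) : ℝ) - c else 0) = ∫ u, φ u z ∂ν := fun z => by
    by_cases h : (f z : ℝ) ≤ t
    · simp only [hφ, h, if_true]
      rw [integral_sub (hstep _) (hstep _), integral_ite_lt (g (f z)).2.1 (g (f z)).2.2,
        integral_ite_lt h0 h1]
    · simp [hφ, h]
  have hφ1 : ∀ u z, |φ u z| ≤ 1 := fun u z => by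
    simp only [hφ]
    split_ifs <;> simp
  have hjoint : Integrable (Function.uncurry fun z u => φ u z) (P.prod ν) := by
    refine Integrable.of_bound (Measurable.aestronglyMeasurable ?_) 1
      (ae_of_all _ fun x => hφ1 _ _)
    refine measurable_from_prod_countable_right fun z => ?_
    simp only [Function.uncurry, hφ]
    by_cases h : (f z : ℝ) ≤ t
    · simp only [h, if_true]
      exact (Measurable.ite measurableSet_Iio measurable_const measurable_const).sub
        (Measurable.ite measurableSet_Iio measurable_const measurable_const)
    · simp [h]
  simp_rw [hψ]
  rw [integral_integral_swap hjoint, ← integral_finsetSum _ fun i _ => hφint (D i),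
    ← integral_const_mul, ← integral_sub (f := fun u => ∫ z, φ u z ∂P) hjoint.integral_prod_right
      ((integrable_finsetSum _ fun i _ => hφint (D i)).const_mul _)]
  have hmain : ∀ u, |(∫ z, φ u z ∂P) - 1 / (n : ℝ) * ∑ i, φ u (D i)| ≤ ε := by
    intro u
    obtain ⟨p, hp⟩ := exists_threshold hg hm u
    have hlt : ∀ z, u < (g (f z) : ℝ) ↔ ¬ (f z : ℝ) ≤ p := fun z => by rw [hp, not_le]
    -- Each layer is a single signed interval: minus `{f ≤ min p t}` when `u < c`, plus `{p < f ≤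
    -- t}` otherwise. Hence the shift by `c` costs no additional error.
    by_cases hu : u < c
    · have : ∀ z, φ u z = -(if (-1 : ℝ) < f z ∧ (f z : ℝ) ≤ min p t then (1 : ℝ) else 0) := by
        intro z
        have hf : (-1 : ℝ) < f z := by linarith [(f z).2.1]
        by_cases h : (f z : ℝ) ≤ t <;> by_cases h' : (f z : ℝ) ≤ p <;>
          simp [hφ, hu, h, h', hf, hlt]
      simp_rw [this]
      rw [integral_neg, Finset.sum_neg_distrib, mul_neg, neg_sub_neg, abs_sub_comm]
      exact hD _ _
    · have : ∀ z, φ u z = if p < (f z : ℝ) ∧ (f z : ℝ) ≤ t then (1 : ℝ) else 0 := by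
        intro z
        by_cases h : (f z : ℝ) ≤ t <;> by_cases h' : (f z : ℝ) ≤ p <;>
          simp [hφ, hu, h, h', hlt, -not_le]
      simp_rw [this]
      exact hD _ _
  simpa using norm_integral_le_of_norm_le_const (μ := ν) (C := ε)
    (f := fun u => (∫ z, φ u z ∂P) - 1 / (n : ℝ) * ∑ i, φ u (D i)) (ae_of_all _ hmain)

end LayerCake

/-! ### Sorted samples and ties -/

section Sorted

variable {n : ℕ}

theorem exists_prefix_of_monotone {x : Fin n → I} (hx : Monotone x) (t : ℝ) :
    ∃ k ≤ n, ∀ i, (x i : ℝ) ≤ t ↔ (i : ℕ) < k := by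
  classical
  have hex : ∃ k, ∀ i : Fin n, k ≤ (i : ℕ) → t < (x i : ℝ) :=
    ⟨n, fun i hi => absurd i.2 (not_lt.2 hi)⟩
  refine ⟨Nat.find hex, Nat.find_le fun i hi => absurd i.2 (not_lt.2 hi), fun i =>
    ⟨fun h => ?_, fun h => ?_⟩⟩
  · by_contra hlt
    exact absurd (Nat.find_spec hex i (not_lt.1 hlt)) (not_lt.2 h)
  · have := Nat.find_min hex h
    push Not at this
    obtain ⟨j, hij, hj⟩ := this
    exact (Subtype.coe_le_coe.2 (hx (Fin.le_def.2 hij))).trans hj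

variable {X : Type*} {f₀ : X → I} {D : Fin n → X × ℤˣ} {π : Equiv.Perm (Fin n)} {k : ℕ} {t : ℝ}

theorem sum_score_le_eq (hk : k ≤ n) (h : ∀ i, (f₀ (D (π i)).1 : ℝ) ≤ t ↔ (i : ℕ) < k) :
    ∑ i, (if (f₀ (D i).1 : ℝ) ≤ t then (1 : ℝ) else 0) = k := by
  rw [← Equiv.sum_comp π]
  simp_rw [h]
  rw [sum_ite_val_lt hk fun _ => 1]
  simp

theorem sum_score_le_and_label_eq (h : ∀ i, (f₀ (D (π i)).1 : ℝ) ≤ t ↔ (i : ℕ) < k) :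
    ∑ i, (if (f₀ (D i).1 : ℝ) ≤ t ∧ (D i).2 = 1 then (1 : ℝ) else 0)
      = cumLabels (fun j => (D (π j)).2) k := by
  rw [← Equiv.sum_comp π]
  simp_rw [h]
  rfl

theorem sum_output_eq {g : I → I} (hk : k ≤ n)
    (h : ∀ i, (f₀ (D (π i)).1 : ℝ) ≤ t ↔ (i : ℕ) < k)
    (hg : ∀ i : Fin n, (g (f₀ (D (π i)).1) : ℝ) =
      hullHeight (fun j => (D (π j)).2) ((i : ℕ) + 1) - hullHeight (fun j => (D (π j)).2) (i : ℕ)) :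
    ∑ i, (if (f₀ (D i).1 : ℝ) ≤ t then (g (f₀ (D i).1) : ℝ) else 0)
      = hullHeight (fun j => (D (π j)).2) k := by
  rw [← Equiv.sum_comp π]
  simp_rw [h, hg]
  rw [sum_ite_val_lt hk fun i => hullHeight (fun j => (D (π j)).2) (i + 1)
    - hullHeight (fun j => (D (π j)).2) i, Finset.sum_range_sub, hullHeight_zero, sub_zero]

/-- An affine minorant of the cumulative labels of a sorted sample only has to be checked at
the boundaries of the blocks of equal scores. -/
theorem le_cumLabels_of_isPAVOutput {g : I → I} {m c : ℝ}
    (hmono : Monotone fun i => f₀ (D (π i)).1)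
    (hg : ∀ i : Fin n, (g (f₀ (D (π i)).1) : ℝ) =
      hullHeight (fun j => (D (π j)).2) ((i : ℕ) + 1) - hullHeight (fun j => (D (π j)).2) (i : ℕ))
    (h : ∀ (s : ℝ), ∀ k ≤ n, (∀ i, (f₀ (D (π i)).1 : ℝ) ≤ s ↔ (i : ℕ) < k) →
      m + c * k ≤ cumLabels (fun j => (D (π j)).2) k) :
    ∀ j ≤ n, m + c * j ≤ cumLabels (fun j => (D (π j)).2) j := by
  refine le_cumLabels_of_kinks _ ?_ ?_ ?_
  · refine h (-1) 0 (Nat.zero_le _) fun i => ?_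
    have := (f₀ (D (π i)).1).2.1
    simp only [Nat.not_lt_zero, iff_false, not_le]
    linarith
  · exact h 1 n le_rfl fun i => by simp [(f₀ (D (π i)).1).2.2]
  -- Equal scores on both sides would force equal hull increments, so a kink occurs only where the
  -- score strictly increases; the prefix is then a full sublevel set.
  · intro j hj hkink
    refine h (f₀ (D (π ⟨j, by omega⟩)).1) (j + 1) (by omega) fun i => ⟨fun hi => ?_, fun hi => ?_⟩
    · by_contra hlt
      have h1 : f₀ (D (π ⟨j + 1, hj⟩)).1 ≤ f₀ (D (π i)).1 :=
        hmono (Fin.le_def.2 (not_lt.1 hlt))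
      have h2 : f₀ (D (π ⟨j, by omega⟩)).1 ≤ f₀ (D (π ⟨j + 1, hj⟩)).1 :=
        hmono (Fin.le_def.2 (Nat.le_succ j))
      have h3 : f₀ (D (π ⟨j, by omega⟩)).1 = f₀ (D (π ⟨j + 1, hj⟩)).1 :=
        le_antisymm h2 (h1.trans (Subtype.coe_le_coe.1 hi))
      have h4 := hg ⟨j, by omega⟩
      have h5 := hg ⟨j + 1, hj⟩
      rw [h3, h5] at h4
      simp only at h4
      linarith
    · exact Subtype.coe_le_coe.2 (hmono (Fin.le_def.2 (Nat.lt_succ_iff.1 hi)))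

end Sorted

/-! ### The population curve -/

section Population

variable {X : Type*} [MeasurableSpace X] (P : Measure (X × ℤˣ)) [IsProbabilityMeasure P]
  (f₀ : X → I)

theorem integral_ite_one {Z : Type*} [MeasurableSpace Z] [DiscreteMeasurableSpace Z]
    (μ : Measure Z) (p : Z → Prop) [DecidablePred p] :
    ∫ z, (if p z then (1 : ℝ) else 0) ∂μ = μ.real {z | p z} := by
  rw [← integral_indicator_one (μ := μ) (s := {z | p z}) .of_discrete]
  refine integral_congr_ae (ae_of_all _ fun z => ?_)
  simp [Set.indicator_apply]

theorem distG_mono {s t : ℝ} (h : s ≤ t) : distG P f₀ s ≤ distG P f₀ t :=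
  measureReal_mono fun _ hz => ⟨hz.1.trans h, hz.2⟩

variable [Countable X] [DiscreteMeasurableSpace X]

/-- `F - G` is the mass of the label `-1` below the threshold, hence also nondecreasing. -/
theorem distG_sub_le {s t : ℝ} (h : s ≤ t) :
    distG P f₀ t - distG P f₀ s ≤ distF P f₀ t - distF P f₀ s := by
  have hsub : ∀ t, distF P f₀ t - distG P f₀ t
      = P.real {z : X × ℤˣ | (f₀ z.1 : ℝ) ≤ t ∧ z.2 ≠ 1} := by
    intro t
    rw [distF, distG, sub_eq_iff_eq_add', ← measureReal_union]
    · congr 1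
      ext z
      simp only [Set.mem_ofPred_eq, Set.mem_union]
      tauto
    · rw [Set.disjoint_left]
      rintro z ⟨-, h1⟩ ⟨-, h2⟩
      exact h2 h1
    · exact .of_discrete
  have : distF P f₀ s - distG P f₀ s ≤ distF P f₀ t - distG P f₀ t := by
    rw [hsub, hsub]
    exact measureReal_mono fun _ hz => ⟨hz.1.trans h, hz.2⟩
  linarith

theorem isLipschitzGraph_range :
    IsLipschitzGraph (Set.range fun t : ℝ => (distF P f₀ t, distG P f₀ t)) where
  zero_mem := by
    refine ⟨-1, ?_⟩
    have h : ∀ z : X × ℤˣ, ¬ (f₀ z.1 : ℝ) ≤ -1 := fun z => by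
      have := (f₀ z.1).2.1
      intro h
      linarith
    simp [distF, distG, h]
  fst_nonneg := by
    rintro _ ⟨t, rfl⟩
    exact measureReal_nonneg
  monotone := by
    rintro _ ⟨s, rfl⟩ _ ⟨t, rfl⟩ h
    rcases le_total s t with hst | hst
    · exact distG_mono P f₀ hst
    · have := distG_sub_le P f₀ hst
      simp only at h ⊢
      linarith
  lipschitz := by
    rintro _ ⟨s, rfl⟩ _ ⟨t, rfl⟩ h
    rcases le_total s t with hst | hst
    · exact distG_sub_le P f₀ hst
    · have := distG_mono P f₀ hst
      simp only at h ⊢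
      linarith

theorem Ge_sub_mul_distF (g : I → I) (c t : ℝ) :
    Ge P f₀ g t - c * distF P f₀ t
      = ∫ z, (if (f₀ z.1 : ℝ) ≤ t then (g (f₀ z.1) : ℝ) - c else 0) ∂P := by
  rw [distF, ← integral_ite_one, ← integral_const_mul, Ge, ← integral_sub]
  · refine integral_congr_ae (ae_of_all _ fun z => ?_)
    by_cases h : (f₀ z.1 : ℝ) ≤ t <;> simp [h]
  · refine integrable_of_abs_le _ (B := 1) fun z => ?_
    have h1 := (g (f₀ z.1)).2.1
    have h2 := (g (f₀ z.1)).2.2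
    split_ifs
    · rwa [abs_of_nonneg h1]
    · simp
  · refine (integrable_of_abs_le _ (B := 1) fun z => ?_).const_mul _
    split_ifs <;> simp

/-- If the regression function is monotone, the population curve is its own lower hull. -/
theorem MonotoneRegression.cv_distF {P : Measure (X × ℤˣ)} [IsProbabilityMeasure P] {f₀ : X → I}
    (h : MonotoneRegression P f₀) (t : I) : cv P f₀ (distF P f₀ t) = distG P f₀ t := by
  obtain ⟨m, hm, hae⟩ := h
  have hle : MeasurableSpace.comap (fun z : X × ℤˣ => f₀ z.1) inferInstance
      ≤ (Prod.instMeasurableSpace : MeasurableSpace (X × ℤˣ)) := fun s _ => .of_discrete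
  have hmint : Integrable (fun z : X × ℤˣ => m (f₀ z.1)) P := integrable_condExp.congr hae
  have hG : ∀ s : ℝ, distG P f₀ s
      = ∫ z, (if (f₀ z.1 : ℝ) ≤ s then m (f₀ z.1) else 0) ∂P := by
    intro s
    have hs : MeasurableSet[MeasurableSpace.comap (fun z : X × ℤˣ => f₀ z.1) inferInstance]
        {z : X × ℤˣ | (f₀ z.1 : ℝ) ≤ s} :=
      ⟨{x | (x : ℝ) ≤ s}, measurableSet_le (by fun_prop) measurable_const, rfl⟩
    have hint : Integrable (fun z : X × ℤˣ => if z.2 = 1 then (1 : ℝ) else 0) P :=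
      integrable_of_abs_le _ (B := 1) fun z => by split_ifs <;> simp
    have h1 := setIntegral_condExp hle hint hs
    rw [setIntegral_congr_ae (g := fun z => m (f₀ z.1)) .of_discrete
      (hae.mono fun z hz _ => hz), ← integral_indicator .of_discrete,
      ← integral_indicator .of_discrete] at h1
    rw [distG, ← integral_ite_one]
    refine Eq.trans ?_ (h1.symm.trans ?_) <;>
    · refine integral_congr_ae (ae_of_all _ fun z => ?_)
      by_cases h : (f₀ z.1 : ℝ) ≤ s <;> simp [h]
  have hmem := subset_convexHull ℝ (Set.range fun t : ℝ => (distF P f₀ t, distG P f₀ t))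
    ⟨(t : ℝ), rfl⟩
  refine le_antisymm ((isLipschitzGraph_range P f₀).lowerHull_le hmem) ?_
  -- The regression value `m t` is the slope of a supporting line at `t`.
  have hline := le_lowerHull (m := distG P f₀ t - m t * distF P f₀ t) (c := m t) ?_ hmem
  · simpa [cv] using hline
  rintro _ ⟨s, rfl⟩
  simp only
  have hi : ∀ s : ℝ, Integrable (fun z : X × ℤˣ => if (f₀ z.1 : ℝ) ≤ s then m (f₀ z.1) else 0) P :=
    fun s => (hmint.indicator (s := {z : X × ℤˣ | (f₀ z.1 : ℝ) ≤ s}) .of_discrete).congr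
      (ae_of_all _ fun z => by simp [Set.indicator_apply])
  have hi1 : ∀ s : ℝ, Integrable (fun z : X × ℤˣ => if (f₀ z.1 : ℝ) ≤ s then (1 : ℝ) else 0) P :=
    fun s => integrable_of_abs_le _ (B := 1) fun z => by split_ifs <;> simp
  -- The integrand is `(m (f₀ x) - m t) (𝟙[f₀ x ≤ s] - 𝟙[f₀ x ≤ t])`, whose factors have the same
  -- sign wherever the second is nonzero.
  have key : 0 ≤ ∫ z, ((if (f₀ z.1 : ℝ) ≤ s then m (f₀ z.1) else 0)
      - (if (f₀ z.1 : ℝ) ≤ t then m (f₀ z.1) else 0))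
      - m t * ((if (f₀ z.1 : ℝ) ≤ s then (1 : ℝ) else 0)
        - (if (f₀ z.1 : ℝ) ≤ t then (1 : ℝ) else 0)) ∂P := by
    refine integral_nonneg fun z => ?_
    by_cases h1 : (f₀ z.1 : ℝ) ≤ s <;> by_cases h2 : (f₀ z.1 : ℝ) ≤ t
    · simp [h1, h2]
    · have := hm (Subtype.coe_le_coe.1 (not_le.1 h2).le)
      simpa [h1, h2] using this
    · have := hm (Subtype.coe_le_coe.1 h2)
      simpa [h1, h2] using this
    · simp [h1, h2]
  rw [integral_sub (f := fun z : X × ℤˣ => (if (f₀ z.1 : ℝ) ≤ s then m (f₀ z.1) else 0)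
      - (if (f₀ z.1 : ℝ) ≤ t then m (f₀ z.1) else 0))
      (g := fun z : X × ℤˣ => m t * ((if (f₀ z.1 : ℝ) ≤ s then (1 : ℝ) else 0)
        - (if (f₀ z.1 : ℝ) ≤ t then (1 : ℝ) else 0)))
      ((hi s).sub (hi t)) (((hi1 s).sub (hi1 t)).const_mul _),
    integral_sub (hi s) (hi t), integral_const_mul, integral_sub (hi1 s) (hi1 t), ← hG, ← hG,
    integral_ite_one, integral_ite_one] at key
  change 0 ≤ distG P f₀ s - distG P f₀ t - m t * (distF P f₀ s - distF P f₀ t) at key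
  linarith

end Population

/-! ### Accurate samples: the deterministic estimate -/

section Accuracy

variable {X : Type*} [MeasurableSpace X] {n : ℕ}

/-- The indicator `𝟙[p₁ < f₀(x) ≤ p₂]`. -/
noncomputable def intervalIndicator (f₀ : X → I) (p : ℝ × ℝ) (z : X × ℤˣ) : ℝ :=
  if p.1 < (f₀ z.1 : ℝ) ∧ (f₀ z.1 : ℝ) ≤ p.2 then 1 else 0

/-- The difference between the mean and the empirical mean of a function. -/
noncomputable def meanError {Z : Type*} [MeasurableSpace Z] (P : Measure Z) (D : Fin n → Z)
    (h : Z → ℝ) : ℝ :=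
  (∫ z, h z ∂P) - (1 / (n : ℝ)) * ∑ i, h (D i)

/-- The sample `D` is `ε`-accurate for the probabilities of intervals of scores, with and
without a prescribed label. -/
structure IsAccurate (P : Measure (X × ℤˣ)) (f₀ : X → I) (ε : ℝ) (D : Fin n → X × ℤˣ) : Prop where
  interval : ∀ p, |meanError P D (intervalIndicator f₀ p)| ≤ ε
  label : ∀ p (l : ℤˣ),
    |meanError P D fun z => (if z.2 = l then 1 else 0) * intervalIndicator f₀ p z| ≤ ε

variable [Countable X] [DiscreteMeasurableSpace X] {P : Measure (X × ℤˣ)} [IsProbabilityMeasure P]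
  {f₀ : X → I} {ε : ℝ} {D : Fin n → X × ℤˣ}

/-- Write `G - c F = (1 - c) G - c (F - G)`: the two label masses carry weights of total size `1`,
so the error is `ε` rather than `(1 + c) ε`. -/
theorem IsAccurate.abs_curve_sub_le (h : IsAccurate P f₀ ε D) {c : ℝ} (h0 : 0 ≤ c) (h1 : c ≤ 1)
    (s : ℝ) :
    |(distG P f₀ s - c * distF P f₀ s) - (1 / (n : ℝ)) *
      ((∑ i, (if (f₀ (D i).1 : ℝ) ≤ s ∧ (D i).2 = 1 then (1 : ℝ) else 0))
        - c * ∑ i, (if (f₀ (D i).1 : ℝ) ≤ s then (1 : ℝ) else 0))| ≤ ε := by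
  have hp := h.label (-1, s) 1
  have hq := h.label (-1, s) (-1)
  have hlt : ∀ x : I, (-1 : ℝ) < x := fun x => by linarith [x.2.1]
  simp only [intervalIndicator, meanError, hlt, true_and] at hp hq
  have e1 : ∀ z : X × ℤˣ, (if z.2 = 1 then (1 : ℝ) else 0) * (if (f₀ z.1 : ℝ) ≤ s then 1 else 0)
      = if (f₀ z.1 : ℝ) ≤ s ∧ z.2 = 1 then 1 else 0 := fun z => by
    by_cases h1 : z.2 = 1 <;> simp [h1]
  have e2 : ∀ z : X × ℤˣ, (if z.2 = -1 then (1 : ℝ) else 0) * (if (f₀ z.1 : ℝ) ≤ s then 1 else 0)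
      = (if (f₀ z.1 : ℝ) ≤ s then 1 else 0) - if (f₀ z.1 : ℝ) ≤ s ∧ z.2 = 1 then 1 else 0 :=
    fun z => by
    rcases Int.units_eq_one_or z.2 with h1 | h1 <;> simp [h1]
  simp_rw [e1] at hp
  simp_rw [e2] at hq
  rw [integral_sub (integrable_of_abs_le _ (B := 1) fun z => by split_ifs <;> simp)
    (integrable_of_abs_le _ (B := 1) fun z => by split_ifs <;> simp), integral_ite_one,
    integral_ite_one, Finset.sum_sub_distrib] at hq
  rw [integral_ite_one] at hp
  change |distG P f₀ s - _| ≤ ε at hp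
  change |distF P f₀ s - distG P f₀ s - _| ≤ ε at hq
  rw [abs_le] at hp hq ⊢
  have h1' := sub_nonneg.2 h1
  have a1 := mul_le_mul_of_nonneg_left hp.1 h1'
  have a2 := mul_le_mul_of_nonneg_left hp.2 h1'
  have a3 := mul_le_mul_of_nonneg_left hq.1 h0
  have a4 := mul_le_mul_of_nonneg_left hq.2 h0
  constructor <;> linarith

/-- On accurate samples, the integrated output of the PAV algorithm is close to the lower hull of
the population curve. -/
theorem IsAccurate.abs_Ge_sub_cv_le (hn : 0 < n) (h : IsAccurate P f₀ ε D) {g : I → I}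
    (hg : IsPAVOutput f₀ D g) (t : ℝ) :
    |Ge P f₀ g t - cv P f₀ (distF P f₀ t)| ≤ 2 * ε := by
  obtain ⟨hcont, hmono, π, hsort, hval⟩ := hg
  have hn' : (0 : ℝ) < n := by exact_mod_cast hn
  set y : Fin n → ℤˣ := fun j => (D (π j)).2
  obtain ⟨k, hk, hkt⟩ := exists_prefix_of_monotone hsort t
  have hcurve : ∀ {c : ℝ}, 0 ≤ c → c ≤ 1 → ∀ {s : ℝ} {j : ℕ}, j ≤ n →
      (∀ i, (f₀ (D (π i)).1 : ℝ) ≤ s ↔ (i : ℕ) < j) →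
      |(distG P f₀ s - c * distF P f₀ s) - (1 / (n : ℝ)) * (cumLabels y j - c * j)| ≤ ε := by
    intro c h0 h1 s j hj hjs
    have := h.abs_curve_sub_le h0 h1 s
    rwa [sum_score_le_eq hj hjs, sum_score_le_and_label_eq hjs] at this
  have hGe : ∀ {c : ℝ}, 0 ≤ c → c ≤ 1 →
      |(Ge P f₀ g t - c * distF P f₀ t) - (1 / (n : ℝ)) * (hullHeight y k - c * k)| ≤ ε := by
    intro c h0 h1
    have := abs_integral_sub_average_le P (fun z => f₀ z.1) D
      (fun p₁ p₂ => h.interval (p₁, p₂)) hcont hmono h0 h1 t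
    rw [← Ge_sub_mul_distF] at this
    convert this using 4
    rw [← sum_output_eq hk hkt hval, ← sum_score_le_eq hk hkt, Finset.mul_sum,
      ← Finset.sum_sub_distrib]
    refine Finset.sum_congr rfl fun i _ => ?_
    split_ifs <;> simp
  have hmem := subset_convexHull ℝ (Set.range fun t : ℝ => (distF P f₀ t, distG P f₀ t))
    ⟨t, rfl⟩
  rw [abs_le]
  constructor
  · obtain ⟨c, h0, h1, hc⟩ :=
      (isLipschitzGraph_range P f₀).exists_supporting_line ⟨t, rfl⟩
    change ∀ p : ℝ × ℝ, p ∈ _ → cv P f₀ (distF P f₀ t) + c * (p.1 - distF P f₀ t) ≤ p.2 at hc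
    -- The supporting line of the population hull, lowered by `ε` and rescaled by `n`, stays below
    -- the empirical curve at block ends, hence everywhere.
    have hlow := le_cumLabels_of_isPAVOutput
      (m := n * (cv P f₀ (distF P f₀ t) - c * distF P f₀ t - ε)) (c := c) hsort hval (by
        intro s j hj hjs
        have h2 := (abs_le.1 (hcurve h0 h1 hj hjs)).2
        have h3 := hc _ ⟨s, rfl⟩
        simp only at h3
        have h4 : cv P f₀ (distF P f₀ t) - c * distF P f₀ t - ε
            ≤ (1 / (n : ℝ)) * (cumLabels y j - c * j) := by linarith
        rw [one_div, ← div_eq_inv_mul, le_div_iff₀' hn'] at h4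
        linarith)
    have h2 := le_hullHeight y hlow hk
    have h3 := (abs_le.1 (hGe h0 h1)).1
    have h4 : cv P f₀ (distF P f₀ t) - c * distF P f₀ t - ε
        ≤ (1 / (n : ℝ)) * (hullHeight y k - c * k) := by
      rw [one_div, ← div_eq_inv_mul, le_div_iff₀' hn']
      linarith
    linarith
  · obtain ⟨c, h0, h1, hc⟩ :=
      (isLipschitzGraph_points y).exists_supporting_line (mem_points y hk)
    change ∀ p : ℝ × ℝ, p ∈ _ → hullHeight y k + c * (p.1 - k) ≤ p.2 at hc
    -- Conversely, a supporting line of the empirical hull, lowered by `ε`, stays below the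
    -- population curve; every `s` corresponds to some prefix, so ties play no role.
    have hlow := le_lowerHull
      (m := (1 / (n : ℝ)) * (hullHeight y k - c * k) - ε) (c := c) (by
        rintro _ ⟨s, rfl⟩
        obtain ⟨j, hj, hjs⟩ := exists_prefix_of_monotone hsort s
        have h2 := (abs_le.1 (hcurve h0 h1 hj hjs)).1
        have h3 := hc _ (mem_points y hj)
        have h4 : (1 / (n : ℝ)) * (hullHeight y k - c * k)
            ≤ (1 / (n : ℝ)) * (cumLabels y j - c * j) :=
          mul_le_mul_of_nonneg_left (by simp only at h3; linarith) (by positivity)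
        simp only
        linarith) hmem
    change _ ≤ cv P f₀ (distF P f₀ t) at hlow
    have h3 := (abs_le.1 (hGe h0 h1)).2
    linarith

end Accuracy

/-! ### Probability of an inaccurate sample -/

section Probability

variable {X : Type*} {n : ℕ}

theorem integrable_rademacherFamily {Z ι : Type*} [Countable Z] [MeasurableSpace Z]
    [DiscreteMeasurableSpace Z] [Nonempty ι] {g : ι → Z → ℝ} (hg : ∀ a z, |g a z| ≤ 1)
    (μ : Measure (Fin n → Z)) [IsFiniteMeasure μ] : Integrable (rademacherFamily g) μ :=
  ((integrable_finsetSum _ fun s _ =>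
    integrable_of_abs_le _ (abs_signedSup_le hg s)).const_mul _).const_mul _

theorem abs_intervalIndicator_le (f₀ : X → I) (p : ℝ × ℝ) (z : X × ℤˣ) :
    |intervalIndicator f₀ p z| ≤ 1 := by
  unfold intervalIndicator
  split_ifs <;> simp

theorem rademacherFamily_intervalIndicator_le {ℱ : Set (X → I)} {f₀ : X → I} (hf₀ : f₀ ∈ ℱ)
    (D : Fin n → X × ℤˣ) :
    rademacherFamily (intervalIndicator f₀) D ≤ rademacher (thresholdClass ℱ) D := by
  rw [rademacher_eq_rademacherFamily]
  refine rademacherFamily_comp_le (g := fun a : thresholdClass ℱ => (a : X × ℤˣ → ℝ)) ?_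
    (fun p : ℝ × ℝ => ⟨intervalIndicator f₀ p, f₀, hf₀, p.1, p.2, rfl⟩) D
  rintro ⟨_, f, -, p₁, p₂, rfl⟩ z
  simp only
  split_ifs <;> simp

variable [Countable X] [MeasurableSpace X] [DiscreteMeasurableSpace X]

theorem integrable_rademacher_thresholdClass {ℱ : Set (X → I)} (hℱ : ℱ.Nonempty)
    (μ : Measure (Fin n → X × ℤˣ)) [IsFiniteMeasure μ] :
    Integrable (fun D => rademacher (thresholdClass ℱ) D) μ := by
  obtain ⟨f, hf⟩ := hℱ
  have : Nonempty (thresholdClass ℱ) := ⟨⟨_, f, hf, 0, 0, rfl⟩⟩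
  refine integrable_rademacherFamily (g := fun a : thresholdClass ℱ => (a : X × ℤˣ → ℝ)) ?_ μ
  rintro ⟨_, f, -, p₁, p₂, rfl⟩ z
  simp only
  split_ifs <;> simp

/-- The weight `e` or `e 𝟙[y = l]` on labelled points, as the mean of two signs. -/
noncomputable def labelWeight (e : ℤˣ) (o : Option ℤˣ) (z : X × ℤˣ) : ℝ :=
  (((e : ℤ) : ℝ) + (((e * o.elim 1 (fun l => l * z.2) : ℤˣ) : ℤ) : ℝ)) / 2

theorem measureReal_not_isAccurate_lt (P : Measure (X × ℤˣ)) [IsProbabilityMeasure P]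
    {ℱ : Set (X → I)} {f₀ : X → I} (hf₀ : f₀ ∈ ℱ) (hn : 0 < n) {ε δ : ℝ} (hδ : 0 < δ)
    (hR : (∫ D, rademacher (thresholdClass ℱ) D ∂(Measure.pi fun _ : Fin n => P))
        + Real.sqrt (2 * Real.log (8 / δ) / n) < ε / 2) :
    (Measure.pi fun _ : Fin n => P).real {D | ¬ IsAccurate P f₀ ε D} < 5 * δ := by
  set μ : Measure (Fin n → X × ℤˣ) := Measure.pi fun _ => P
  -- Two signs turn two-sided bounds into one-sided ones; the option selects no label or one of two.
  -- The six failures total at most `6 δ / 8 < 5 δ`.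
  set G : ℤˣ × Option ℤˣ → ℝ × ℝ → X × ℤˣ → ℝ := fun j p z =>
    labelWeight j.1 j.2 z * intervalIndicator f₀ p z with hG
  have hweight : ∀ e o (z : X × ℤˣ), |labelWeight e o z| ≤ 1 := by
    intro e o z
    rw [labelWeight, abs_div, abs_two, div_le_one two_pos]
    exact (abs_add_le _ _).trans (by rw [abs_intUnit, abs_intUnit]; norm_num)
  have hGb : ∀ j p z, |G j p z| ≤ 1 := fun j p z => by
    rw [hG]
    simp only [abs_mul]
    exact mul_le_one₀ (hweight _ _ _) (abs_nonneg _) (abs_intervalIndicator_le _ _ _)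
  have hbad : ∀ j, μ.real {D | ε ≤ deviation P (G j) D} ≤ δ / 8 := by
    intro j
    refine measureReal_le_deviation_le P (hGb j) hn hδ (lt_of_le_of_lt ?_ hR)
    refine add_le_add_left (integral_mono (integrable_rademacherFamily (hGb j) _)
      (integrable_rademacher_thresholdClass ⟨f₀, hf₀⟩ _) fun D => ?_) _
    exact (rademacherFamily_mul_le (abs_intervalIndicator_le f₀) (fun _ => j.1)
      (fun z => j.1 * j.2.elim 1 (fun l => l * z.2)) D).trans
      (rademacherFamily_intervalIndicator_le hf₀ D)
  have hsub : {D | ¬ IsAccurate P f₀ ε D} ⊆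
      ⋃ j, {D : Fin n → X × ℤˣ | ε ≤ deviation P (G j) D} := by
    intro D hD
    by_contra hnot
    simp only [Set.mem_iUnion, Set.mem_ofPred_eq, not_exists, not_le] at hnot
    have hlt : ∀ e o p, meanError P D (fun z => labelWeight e o z * intervalIndicator f₀ p z) ≤ ε :=
      fun e o p => (le_deviation P (hGb (e, o)) D p).trans (hnot (e, o)).le
    have habs : ∀ o p,
        |meanError P D fun z => labelWeight 1 o z * intervalIndicator f₀ p z| ≤ ε := by
      intro o p
      refine abs_le.2 ⟨?_, hlt 1 o p⟩
      have h1 := hlt (-1) o p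
      have h2 : ∀ z : X × ℤˣ, labelWeight (-1) o z = -labelWeight 1 o z := fun z => by
        simp only [labelWeight, neg_mul, one_mul, Units.val_neg, Int.cast_neg, Units.val_one]
        ring
      simp only [meanError, h2, neg_mul, integral_neg, Finset.sum_neg_distrib] at h1
      rw [meanError]
      linarith
    refine hD ⟨fun p => ?_, fun p l => ?_⟩
    · simpa [labelWeight] using habs none p
    -- For signs, `𝟙[y = l] = (1 + l y) / 2`.
    · have h2 : ∀ z : X × ℤˣ, labelWeight 1 (some l) z = if z.2 = l then 1 else 0 := fun z => by
        rcases Int.units_eq_one_or l with rfl | rfl <;>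
          rcases Int.units_eq_one_or z.2 with h | h <;> simp [labelWeight, h]
      simpa only [h2] using habs (some l) p
  calc μ.real {D | ¬ IsAccurate P f₀ ε D}
      ≤ μ.real (⋃ j, {D : Fin n → X × ℤˣ | ε ≤ deviation P (G j) D}) := measureReal_mono hsub
    _ ≤ ∑ j, μ.real {D : Fin n → X × ℤˣ | ε ≤ deviation P (G j) D} :=
        measureReal_iUnion_fintype_le _
    _ ≤ ∑ _j : ℤˣ × Option ℤˣ, δ / 8 := Finset.sum_le_sum fun j _ => hbad j
    _ < 5 * δ := by
        simp only [Finset.sum_const, Finset.card_univ, Fintype.card_prod, Fintype.card_option,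
          Fintype.card_units_int, nsmul_eq_mul]
        push_cast
        linarith

end Probability

end PAV

theorem mainTheorem4 {X : Type*} [Countable X] [MeasurableSpace X] [DiscreteMeasurableSpace X]
    (P : Measure (X × ℤˣ)) [IsProbabilityMeasure P]
    (ℱ : Set (X → I)) (f₀ : X → I) (hf₀ : f₀ ∈ ℱ)
    (n : ℕ) (hn : 0 < n) (ε δ : ℝ) (hδ : 0 < δ)
    (hR : (∫ D, PAV.rademacher (PAV.thresholdClass ℱ) D ∂(Measure.pi fun _ : Fin n => P))
        + Real.sqrt (2 * Real.log (8 / δ) / n) < ε / 2)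
    (gstar : (Fin n → X × ℤˣ) → I → I)
    (hgstar : ∀ D, PAV.IsPAVOutput f₀ D (gstar D)) :
    (Measure.pi fun _ : Fin n => P).real
        {D | 2 * ε < ⨆ t : I, |PAV.Ge P f₀ (gstar D) t - PAV.cv P f₀ (PAV.distF P f₀ t)|}
      < 5 * δ ∧
    (PAV.MonotoneRegression P f₀ →
      (Measure.pi fun _ : Fin n => P).real
          {D | 2 * ε < ⨆ t : I, |PAV.Ge P f₀ (gstar D) t - PAV.distG P f₀ t|}
        < 5 * δ) := by
  have h1 : (Measure.pi fun _ : Fin n => P).real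
      {D | 2 * ε < ⨆ t : I, |PAV.Ge P f₀ (gstar D) t - PAV.cv P f₀ (PAV.distF P f₀ t)|}
      < 5 * δ := by
    refine (measureReal_mono fun D hD hacc => ?_).trans_lt
      (PAV.measureReal_not_isAccurate_lt P hf₀ hn hδ hR)
    exact absurd (ciSup_le fun t : I => hacc.abs_Ge_sub_cv_le hn (hgstar D) (t : ℝ)) (not_le.2 hD)
  refine ⟨h1, fun hreg => ?_⟩
  simpa only [hreg.cv_distF] using h1
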